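/- Let $\mathscr{A}$ and $\mathscr{B}$ be abelian categories, where $\mathscr{A}$ has enough projectives and enough injectives, and let $\mathrm{Add}(\mathscr{A},\mathscr{B})$ be the category of additive (covariant) functors $\mathscr{A}\to\mathscr{B}$ and natural transformations. For each object $A$ of $\mathscr{A}$ choose an exact sequence $0\to\Omega A\overset{\iota}{\to}P\to A\to 0$ with $P$ projective and an exact sequence $0\to A\to I\overset{\pi}{\to}\Sigma A\to 0$ with $I$ injective. For an additive functor $F$, the left satellite $S_1F$ is the additive functor with $S_1F(A)=\operatorname{Ker}F(\iota)$ and the right satellite $S^1F$ is the additive functor with $S^1F(A)=\operatorname{Coker}F(\pi)$; their values on morphisms are induced by liftings (respectively extensions) of maps along the chosen sequences. Thus $S_1$ and $S^1$ are endofunctors of $\mathrm{Add}(\mathscr{A},\mathscr{B})$. The injective stabilization of $F$ is $\overline{F}=\operatorname{Ker}(\rho_F\colon F\to R^0F)$, where $\rho_F$ is the canonical natural transformation to the zeroth right derived functor, and $\alpha_F\colon\overline{F}\to F$ denotes the inclusion. \textbf{Proposition.} The functor $S^1$ is left adjoint to $S_1$. Moreover, let $c\colon S^1S_1\to 1$ be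 the counit of any adjunction $S^1\dashv S_1$, and let $F\colon\mathscr{A}\to\mathscr{B}$ be an additive functor which is half-exact, i.e. for every short exact sequence $0\to X\to Y\to Z\to 0$ in $\mathscr{A}$ the sequence $F(X)\to F(Y)\to F(Z)$ is exact at $F(Y)$. Then $c_F\colon S^1S_1F\to F$ is isomorphic to the inclusion $\alpha_F\colon\overline{F}\to F$: there is a natural isomorphism $e\colon S^1S_1F\overset{\cong}{\to}\overline{F}$ with $\alpha_F\circ e=c_F$. -/

import Mathlib

open CategoryTheory CategoryTheory.Limits

universe v₁ v₂ u₁ u₂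

set_option linter.unusedSectionVars false

noncomputable section

namespace Satellite

variable {𝒜 : Type u₁} [Category.{v₁} 𝒜] [Abelian 𝒜]
variable {ℬ : Type u₂} [Category.{v₂} ℬ] [Abelian ℬ]

/-! ### Syzygy sequences `0 ⟶ ΩA ⟶ P ⟶ A ⟶ 0` and liftings of maps along them -/

/-- The syzygy object `ΩA` of a projective presentation `P ⟶ A`. -/
abbrev syz {A : 𝒜} (P : ProjectivePresentation A) : 𝒜 := kernel P.f

/-- The inclusion `ι : ΩA ⟶ P`. -/
abbrev syzι {A : 𝒜} (P : ProjectivePresentation A) : syz P ⟶ P.p := kernel.ι P.f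

/-- A lifting of `f : A ⟶ A'` to the projectives of the chosen presentations. -/
def liftP {A A' : 𝒜} (P : ProjectivePresentation A) (P' : ProjectivePresentation A')
    (f : A ⟶ A') : P.p ⟶ P'.p :=
  Projective.factorThru (P.f ≫ f) P'.f

@[simp]
lemma liftP_comp {A A' : 𝒜} (P : ProjectivePresentation A) (P' : ProjectivePresentation A')
    (f : A ⟶ A') : liftP P P' f ≫ P'.f = P.f ≫ f :=
  Projective.factorThru_comp _ _

@[simp]
lemma liftP_comp_assoc {A A' Z : 𝒜} (P : ProjectivePresentation A) (P' : ProjectivePresentation A')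
    (f : A ⟶ A') (k : A' ⟶ Z) : liftP P P' f ≫ P'.f ≫ k = P.f ≫ f ≫ k := by
  rw [← Category.assoc, liftP_comp, Category.assoc]

/-- The map induced by the lifting of `f` on syzygy objects. -/
def liftS {A A' : 𝒜} (P : ProjectivePresentation A) (P' : ProjectivePresentation A')
    (f : A ⟶ A') : syz P ⟶ syz P' :=
  kernel.map P.f P'.f (liftP P P' f) f (by simp)

@[simp]
lemma liftS_comp {A A' : 𝒜} (P : ProjectivePresentation A) (P' : ProjectivePresentation A')
    (f : A ⟶ A') : liftS P P' f ≫ syzι P' = syzι P ≫ liftP P P' f := by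
  simp [liftS, kernel.map]

@[simp]
lemma liftS_comp_assoc {A A' Z : 𝒜} (P : ProjectivePresentation A) (P' : ProjectivePresentation A')
    (f : A ⟶ A') (k : P'.p ⟶ Z) :
    liftS P P' f ≫ syzι P' ≫ k = syzι P ≫ liftP P P' f ≫ k := by
  rw [← Category.assoc, liftS_comp, Category.assoc]

/-- Two maps on syzygy objects which come from liftings of the same map `A ⟶ A'` differ by a map
which factors through the projective `P`. -/
lemma exists_factor_syz {A A' : 𝒜} (P : ProjectivePresentation A) (P' : ProjectivePresentation A')
    {p q : P.p ⟶ P'.p} {a b : syz P ⟶ syz P'} (hpq : p ≫ P'.f = q ≫ P'.f)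
    (ha : a ≫ syzι P' = syzι P ≫ p) (hb : b ≫ syzι P' = syzι P ≫ q) :
    ∃ h : P.p ⟶ syz P', a = b + syzι P ≫ h := by
  refine ⟨kernel.lift P'.f (p - q) (by simp [hpq]), ?_⟩
  rw [← cancel_mono (syzι P')]
  simp [ha, hb]

/-! ### The left satellite -/

/-- The value `Ker (F ι)` of the left satellite of `F` at `A`. -/
abbrev leftSatObj (F : 𝒜 ⥤ ℬ) {A : 𝒜} (P : ProjectivePresentation A) : ℬ :=
  kernel (F.map (syzι P))

/-- The map on kernels of `F ι` induced by a lifting of `f : A ⟶ A'`. -/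
def leftSatMap (F : 𝒜 ⥤ ℬ) {A A' : 𝒜} (P : ProjectivePresentation A)
    (P' : ProjectivePresentation A') (f : A ⟶ A') : leftSatObj F P ⟶ leftSatObj F P' :=
  kernel.map (F.map (syzι P)) (F.map (syzι P')) (F.map (liftS P P' f)) (F.map (liftP P P' f))
    (by rw [← F.map_comp, ← F.map_comp, liftS_comp])

@[simp]
lemma leftSatMap_ι (F : 𝒜 ⥤ ℬ) {A A' : 𝒜} (P : ProjectivePresentation A)
    (P' : ProjectivePresentation A') (f : A ⟶ A') :
    leftSatMap F P P' f ≫ kernel.ι (F.map (syzι P')) =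
      kernel.ι (F.map (syzι P)) ≫ F.map (liftS P P' f) := by
  simp [leftSatMap, kernel.map]

@[simp]
lemma leftSatMap_ι_assoc (F : 𝒜 ⥤ ℬ) {A A' : 𝒜} {Z : ℬ} (P : ProjectivePresentation A)
    (P' : ProjectivePresentation A') (f : A ⟶ A') (k : F.obj (syz P') ⟶ Z) :
    leftSatMap F P P' f ≫ kernel.ι (F.map (syzι P')) ≫ k =
      kernel.ι (F.map (syzι P)) ≫ F.map (liftS P P' f) ≫ k := by
  rw [← Category.assoc, leftSatMap_ι, Category.assoc]

/-- Any lifting of `f` computes the map induced by `f` on the left satellite. -/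
lemma leftSatMap_eq (F : 𝒜 ⥤ ℬ) [F.Additive] {A A' : 𝒜} (P : ProjectivePresentation A)
    (P' : ProjectivePresentation A') (f : A ⟶ A') {p : P.p ⟶ P'.p} {a : syz P ⟶ syz P'}
    (hp : p ≫ P'.f = P.f ≫ f) (ha : a ≫ syzι P' = syzι P ≫ p)
    {g : leftSatObj F P ⟶ leftSatObj F P'}
    (hg : g ≫ kernel.ι (F.map (syzι P')) = kernel.ι (F.map (syzι P)) ≫ F.map a) :
    leftSatMap F P P' f = g := by
  obtain ⟨h, rfl⟩ := exists_factor_syz P P' (hp.trans (liftP_comp P P' f).symm) ha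
    (liftS_comp P P' f)
  rw [← cancel_mono (kernel.ι (F.map (syzι P'))), hg]
  simp

/-- The left satellite `S₁F`, computed with the syzygy sequences given by `P`. -/
@[simps]
def leftSatFunctor (P : ∀ A : 𝒜, ProjectivePresentation A) (F : 𝒜 ⥤ ℬ) [F.Additive] : 𝒜 ⥤ ℬ where
  obj A := leftSatObj F (P A)
  map {A A'} f := leftSatMap F (P A) (P A') f
  map_id A := leftSatMap_eq F _ _ _ (p := 𝟙 _) (a := 𝟙 _) (by simp) (by simp) (by simp)
  map_comp {A A' A''} f g :=
    leftSatMap_eq F _ _ _ (p := liftP (P A) (P A') f ≫ liftP (P A') (P A'') g)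
      (a := liftS (P A) (P A') f ≫ liftS (P A') (P A'') g) (by simp) (by simp) (by simp)

instance (P : ∀ A : 𝒜, ProjectivePresentation A) (F : 𝒜 ⥤ ℬ) [F.Additive] :
    (leftSatFunctor P F).Additive where
  map_add {A A'} {f g} :=
    leftSatMap_eq F _ _ _ (p := liftP (P A) (P A') f + liftP (P A) (P A') g)
      (a := liftS (P A) (P A') f + liftS (P A) (P A') g) (by simp) (by simp)
      (g := leftSatMap F (P A) (P A') f + leftSatMap F (P A) (P A') g)
      (by rw [Preadditive.add_comp]; simp)

/-- The map `S₁F(A) ⟶ S₁G(A)` induced by a natural transformation `F ⟶ G`. -/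
def leftSatTrans {F G : 𝒜 ⥤ ℬ} (τ : F ⟶ G) {A : 𝒜} (P : ProjectivePresentation A) :
    leftSatObj F P ⟶ leftSatObj G P :=
  kernel.map (F.map (syzι P)) (G.map (syzι P)) (τ.app _) (τ.app _) (by simp)

@[simp]
lemma leftSatTrans_ι {F G : 𝒜 ⥤ ℬ} (τ : F ⟶ G) {A : 𝒜} (P : ProjectivePresentation A) :
    leftSatTrans τ P ≫ kernel.ι (G.map (syzι P)) = kernel.ι (F.map (syzι P)) ≫ τ.app _ := by
  simp [leftSatTrans, kernel.map]

@[simp]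
lemma leftSatTrans_ι_assoc {F G : 𝒜 ⥤ ℬ} (τ : F ⟶ G) {A : 𝒜} {Z : ℬ}
    (P : ProjectivePresentation A) (k : G.obj (syz P) ⟶ Z) :
    leftSatTrans τ P ≫ kernel.ι (G.map (syzι P)) ≫ k =
      kernel.ι (F.map (syzι P)) ≫ τ.app _ ≫ k := by
  rw [← Category.assoc, leftSatTrans_ι, Category.assoc]

/-- The natural transformation `S₁F ⟶ S₁G` induced by a natural transformation `F ⟶ G`. -/
@[simps]
def leftSatFunctorMap (P : ∀ A : 𝒜, ProjectivePresentation A) {F G : 𝒜 ⥤ ℬ} [F.Additive]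
    [G.Additive] (τ : F ⟶ G) : leftSatFunctor P F ⟶ leftSatFunctor P G where
  app A := leftSatTrans τ (P A)
  naturality A A' f := by
    change leftSatMap F (P A) (P A') f ≫ leftSatTrans τ (P A') =
      leftSatTrans τ (P A) ≫ leftSatMap G (P A) (P A') f
    rw [← cancel_mono (kernel.ι (G.map (syzι (P A'))))]
    simp

/-- The left satellite `S₁` as an endofunctor of the category of additive functors. -/
def leftSat (P : ∀ A : 𝒜, ProjectivePresentation A) : (𝒜 ⥤+ ℬ) ⥤ (𝒜 ⥤+ ℬ) where
  obj F := AdditiveFunctor.of (leftSatFunctor P F.obj)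
  map {F G} τ := ObjectProperty.homMk (leftSatFunctorMap P τ.hom)
  map_id F := by
    ext A
    change leftSatTrans (𝟙 F.obj) (P A) = 𝟙 (leftSatObj F.obj (P A))
    rw [← cancel_mono (kernel.ι (F.obj.map (syzι (P A))))]
    simp
  map_comp {F G H} σ τ := by
    ext A
    change leftSatTrans (σ.hom ≫ τ.hom) (P A) = leftSatTrans σ.hom (P A) ≫ leftSatTrans τ.hom (P A)
    rw [← cancel_mono (kernel.ι (H.obj.map (syzι (P A))))]
    simp

/-! ### Cosyzygy sequences `0 ⟶ A ⟶ I ⟶ ΣA ⟶ 0` and extensions of maps along them -/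

/-- The cosyzygy object `ΣA` of an injective presentation `A ⟶ I`. -/
abbrev cosyz {A : 𝒜} (I : InjectivePresentation A) : 𝒜 := cokernel I.f

/-- The projection `π : I ⟶ ΣA`. -/
abbrev cosyzπ {A : 𝒜} (I : InjectivePresentation A) : I.J ⟶ cosyz I := cokernel.π I.f

/-- An extension of `f : A ⟶ A'` to the injectives of the chosen presentations. -/
def extI {A A' : 𝒜} (I : InjectivePresentation A) (I' : InjectivePresentation A')
    (f : A ⟶ A') : I.J ⟶ I'.J :=
  Injective.factorThru (f ≫ I'.f) I.f

@[simp]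
lemma comp_extI {A A' : 𝒜} (I : InjectivePresentation A) (I' : InjectivePresentation A')
    (f : A ⟶ A') : I.f ≫ extI I I' f = f ≫ I'.f :=
  Injective.comp_factorThru _ _

@[simp]
lemma comp_extI_assoc {A A' Z : 𝒜} (I : InjectivePresentation A) (I' : InjectivePresentation A')
    (f : A ⟶ A') (k : I'.J ⟶ Z) : I.f ≫ extI I I' f ≫ k = f ≫ I'.f ≫ k := by
  rw [← Category.assoc, comp_extI, Category.assoc]

/-- The map induced by the extension of `f` on cosyzygy objects. -/
def extC {A A' : 𝒜} (I : InjectivePresentation A) (I' : InjectivePresentation A')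
    (f : A ⟶ A') : cosyz I ⟶ cosyz I' :=
  cokernel.map I.f I'.f f (extI I I' f) (by simp)

@[simp]
lemma comp_extC {A A' : 𝒜} (I : InjectivePresentation A) (I' : InjectivePresentation A')
    (f : A ⟶ A') : cosyzπ I ≫ extC I I' f = extI I I' f ≫ cosyzπ I' := by
  simp [extC, cokernel.map]

@[simp]
lemma comp_extC_assoc {A A' Z : 𝒜} (I : InjectivePresentation A) (I' : InjectivePresentation A')
    (f : A ⟶ A') (k : cosyz I' ⟶ Z) :
    cosyzπ I ≫ extC I I' f ≫ k = extI I I' f ≫ cosyzπ I' ≫ k := by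
  rw [← Category.assoc, comp_extC, Category.assoc]

/-- Two maps on cosyzygy objects which come from extensions of the same map `A ⟶ A'` differ by a
map which factors through the injective `I'`. -/
lemma exists_factor_cosyz {A A' : 𝒜} (I : InjectivePresentation A) (I' : InjectivePresentation A')
    {p q : I.J ⟶ I'.J} {a b : cosyz I ⟶ cosyz I'} (hpq : I.f ≫ p = I.f ≫ q)
    (ha : cosyzπ I ≫ a = p ≫ cosyzπ I') (hb : cosyzπ I ≫ b = q ≫ cosyzπ I') :
    ∃ h : cosyz I ⟶ I'.J, a = b + h ≫ cosyzπ I' := by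
  refine ⟨cokernel.desc I.f (p - q) (by simp [hpq]), ?_⟩
  rw [← cancel_epi (cosyzπ I)]
  simp [ha, hb]

/-! ### The right satellite -/

/-- The value `Coker (F π)` of the right satellite of `F` at `A`. -/
abbrev rightSatObj (F : 𝒜 ⥤ ℬ) {A : 𝒜} (I : InjectivePresentation A) : ℬ :=
  cokernel (F.map (cosyzπ I))

/-- The map on cokernels of `F π` induced by an extension of `f : A ⟶ A'`. -/
def rightSatMap (F : 𝒜 ⥤ ℬ) {A A' : 𝒜} (I : InjectivePresentation A)
    (I' : InjectivePresentation A') (f : A ⟶ A') : rightSatObj F I ⟶ rightSatObj F I' :=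
  cokernel.map (F.map (cosyzπ I)) (F.map (cosyzπ I')) (F.map (extI I I' f)) (F.map (extC I I' f))
    (by rw [← F.map_comp, ← F.map_comp, comp_extC])

@[simp]
lemma π_rightSatMap (F : 𝒜 ⥤ ℬ) {A A' : 𝒜} (I : InjectivePresentation A)
    (I' : InjectivePresentation A') (f : A ⟶ A') :
    cokernel.π (F.map (cosyzπ I)) ≫ rightSatMap F I I' f =
      F.map (extC I I' f) ≫ cokernel.π (F.map (cosyzπ I')) := by
  simp [rightSatMap, cokernel.map]

@[simp]
lemma π_rightSatMap_assoc (F : 𝒜 ⥤ ℬ) {A A' : 𝒜} {Z : ℬ} (I : InjectivePresentation A)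
    (I' : InjectivePresentation A') (f : A ⟶ A') (k : rightSatObj F I' ⟶ Z) :
    cokernel.π (F.map (cosyzπ I)) ≫ rightSatMap F I I' f ≫ k =
      F.map (extC I I' f) ≫ cokernel.π (F.map (cosyzπ I')) ≫ k := by
  rw [← Category.assoc, π_rightSatMap, Category.assoc]

/-- Any extension of `f` computes the map induced by `f` on the right satellite. -/
lemma rightSatMap_eq (F : 𝒜 ⥤ ℬ) [F.Additive] {A A' : 𝒜} (I : InjectivePresentation A)
    (I' : InjectivePresentation A') (f : A ⟶ A') {p : I.J ⟶ I'.J} {a : cosyz I ⟶ cosyz I'}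
    (hp : I.f ≫ p = f ≫ I'.f) (ha : cosyzπ I ≫ a = p ≫ cosyzπ I')
    {g : rightSatObj F I ⟶ rightSatObj F I'}
    (hg : cokernel.π (F.map (cosyzπ I)) ≫ g = F.map a ≫ cokernel.π (F.map (cosyzπ I'))) :
    rightSatMap F I I' f = g := by
  obtain ⟨h, rfl⟩ := exists_factor_cosyz I I' (hp.trans (comp_extI I I' f).symm) ha
    (comp_extC I I' f)
  rw [← cancel_epi (cokernel.π (F.map (cosyzπ I))), hg]
  simp

/-- The right satellite `S¹F`, computed with the cosyzygy sequences given by `I`. -/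
@[simps]
def rightSatFunctor (I : ∀ A : 𝒜, InjectivePresentation A) (F : 𝒜 ⥤ ℬ) [F.Additive] : 𝒜 ⥤ ℬ where
  obj A := rightSatObj F (I A)
  map {A A'} f := rightSatMap F (I A) (I A') f
  map_id A := rightSatMap_eq F _ _ _ (p := 𝟙 _) (a := 𝟙 _) (by simp) (by simp) (by simp)
  map_comp {A A' A''} f g :=
    rightSatMap_eq F _ _ _ (p := extI (I A) (I A') f ≫ extI (I A') (I A'') g)
      (a := extC (I A) (I A') f ≫ extC (I A') (I A'') g) (by simp) (by simp) (by simp)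

instance (I : ∀ A : 𝒜, InjectivePresentation A) (F : 𝒜 ⥤ ℬ) [F.Additive] :
    (rightSatFunctor I F).Additive where
  map_add {A A'} {f g} :=
    rightSatMap_eq F _ _ _ (p := extI (I A) (I A') f + extI (I A) (I A') g)
      (a := extC (I A) (I A') f + extC (I A) (I A') g) (by simp) (by simp)
      (g := rightSatMap F (I A) (I A') f + rightSatMap F (I A) (I A') g)
      (by rw [Preadditive.comp_add]; simp)

/-- The map `S¹F(A) ⟶ S¹G(A)` induced by a natural transformation `F ⟶ G`. -/
def rightSatTrans {F G : 𝒜 ⥤ ℬ} (τ : F ⟶ G) {A : 𝒜} (I : InjectivePresentation A) :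
    rightSatObj F I ⟶ rightSatObj G I :=
  cokernel.map (F.map (cosyzπ I)) (G.map (cosyzπ I)) (τ.app _) (τ.app _) (by simp)

@[simp]
lemma π_rightSatTrans {F G : 𝒜 ⥤ ℬ} (τ : F ⟶ G) {A : 𝒜} (I : InjectivePresentation A) :
    cokernel.π (F.map (cosyzπ I)) ≫ rightSatTrans τ I =
      τ.app _ ≫ cokernel.π (G.map (cosyzπ I)) := by
  simp [rightSatTrans, cokernel.map]

@[simp]
lemma π_rightSatTrans_assoc {F G : 𝒜 ⥤ ℬ} (τ : F ⟶ G) {A : 𝒜} {Z : ℬ}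
    (I : InjectivePresentation A) (k : rightSatObj G I ⟶ Z) :
    cokernel.π (F.map (cosyzπ I)) ≫ rightSatTrans τ I ≫ k =
      τ.app _ ≫ cokernel.π (G.map (cosyzπ I)) ≫ k := by
  rw [← Category.assoc, π_rightSatTrans, Category.assoc]

/-- The natural transformation `S¹F ⟶ S¹G` induced by a natural transformation `F ⟶ G`. -/
@[simps]
def rightSatFunctorMap (I : ∀ A : 𝒜, InjectivePresentation A) {F G : 𝒜 ⥤ ℬ} [F.Additive]
    [G.Additive] (τ : F ⟶ G) : rightSatFunctor I F ⟶ rightSatFunctor I G where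
  app A := rightSatTrans τ (I A)
  naturality A A' f := by
    change rightSatMap F (I A) (I A') f ≫ rightSatTrans τ (I A') =
      rightSatTrans τ (I A) ≫ rightSatMap G (I A) (I A') f
    rw [← cancel_epi (cokernel.π (F.map (cosyzπ (I A))))]
    simp

/-- The right satellite `S¹` as an endofunctor of the category of additive functors. -/
def rightSat (I : ∀ A : 𝒜, InjectivePresentation A) : (𝒜 ⥤+ ℬ) ⥤ (𝒜 ⥤+ ℬ) where
  obj F := AdditiveFunctor.of (rightSatFunctor I F.obj)
  map {F G} τ := ObjectProperty.homMk (rightSatFunctorMap I τ.hom)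
  map_id F := by
    ext A
    change rightSatTrans (𝟙 F.obj) (I A) = 𝟙 (rightSatObj F.obj (I A))
    rw [← cancel_epi (cokernel.π (F.obj.map (cosyzπ (I A))))]
    simp
  map_comp {F G H} σ τ := by
    ext A
    change rightSatTrans (σ.hom ≫ τ.hom) (I A) =
      rightSatTrans σ.hom (I A) ≫ rightSatTrans τ.hom (I A)
    rw [← cancel_epi (cokernel.π (F.obj.map (cosyzπ (I A))))]
    simp

/-! ### The injective stabilization -/

section InjectiveStabilization

variable [EnoughInjectives 𝒜]

instance (F : 𝒜 ⥤ ℬ) [F.Additive] : (kernel F.toRightDerivedZero).Additive where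
  map_add {X Y} {f g} := by
    rw [← cancel_mono ((kernel.ι F.toRightDerivedZero).app Y)]
    simp

/-- The injective stabilization `F̄` of an additive functor `F`: the kernel of the canonical natural
transformation `F ⟶ R⁰F`. -/
def injStab (F : 𝒜 ⥤+ ℬ) : 𝒜 ⥤+ ℬ :=
  AdditiveFunctor.of (kernel F.obj.toRightDerivedZero)

/-- The inclusion `F̄ ⟶ F`. -/
def injStabι (F : 𝒜 ⥤+ ℬ) : injStab F ⟶ F :=
  ObjectProperty.homMk (kernel.ι F.obj.toRightDerivedZero)

end InjectiveStabilization

/-- `F` is half-exact: for every short exact sequence `0 ⟶ A ⟶ B ⟶ C ⟶ 0`, the sequence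
`F A ⟶ F B ⟶ F C` is exact (at `F B`). -/
def HalfExact (F : 𝒜 ⥤+ ℬ) : Prop :=
  ∀ S : ShortComplex 𝒜, S.ShortExact → (S.map F.obj).Exact

end Satellite

end

/-!
The satellites are adjoint because the syzygy sequence `0 ⟶ ΩA ⟶ P ⟶ A ⟶ 0` maps to the cosyzygy
sequence `0 ⟶ ΩA ⟶ I ⟶ ΣΩA ⟶ 0`, and the syzygy sequence `0 ⟶ ΩΣA ⟶ P ⟶ ΣA ⟶ 0` maps to the
cosyzygy sequence `0 ⟶ A ⟶ I ⟶ ΣA ⟶ 0`. The maps `A ⟶ ΣΩA` and `ΩΣA ⟶ A` obtained in this way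
induce the unit `F A ⟶ S₁S¹F A` and the counit `S¹S₁F A ⟶ F A`. Well-definedness, naturality and
the triangle identities all reduce to one fact and its dual: if two ladders (that is, maps)
between such sequences have the same left (right) end, then their right (left) ends differ by a
map through the injective (projective) middle term, and such maps become zero in the satellites
(`map_comp_eq_of_ladder`, `comp_map_eq_of_ladder`).

If `F` is half-exact and `0 ⟶ X ⟶ Y ⟶ Z ⟶ 0` is exact, then `S₁F Y ⟶ S₁F Z ⟶ F X ⟶ F Y` is exact
(`HalfExact.exists_lift_leftSatMap`, `HalfExact.exists_lift_leftSatObj`): apply `F` to the short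
exact sequences `0 ⟶ ΩY ⟶ K ⟶ X ⟶ 0`, where `K` is the kernel of an epimorphism `R ⟶ Y ⟶ Z` with
`R` projective, and `0 ⟶ ΩZ ⟶ X ⊞ P ⟶ Y ⟶ 0`. For `0 ⟶ A ⟶ I ⟶ ΣA ⟶ 0` this says that the counit
at `F` is a monomorphism with image the kernel of `F A ⟶ F I`. That kernel is the value at `A` of
the injective stabilization (`comp_toRightDerivedZero_eq_zero_iff`). The counit of any other
adjunction differs from the constructed one by an automorphism of `S¹`.
-/

noncomputable section

namespace Satellite

variable {𝒜 : Type u₁} [Category.{v₁} 𝒜] [Abelian 𝒜]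
variable {ℬ : Type u₂} [Category.{v₂} ℬ] [Abelian ℬ]

/-! ### Comparison of ladders with a common end -/

/-- Two maps `Z ⟶ C` which are the right ends of ladders with the same left end differ by a map
which factors through `J`. -/
lemma exists_factor_right {Y Z J C : 𝒜} (g : Y ⟶ Z) [Epi g] (π : J ⟶ C) {p q : Y ⟶ J} {c d : Z ⟶ C}
    (hpq : kernel.ι g ≫ p = kernel.ι g ≫ q) (hc : g ≫ c = p ≫ π) (hd : g ≫ d = q ≫ π) :
    ∃ h : Z ⟶ J, c = d + h ≫ π := by
  refine ⟨Abelian.epiDesc g (p - q) (by simp [hpq]), ?_⟩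
  rw [← cancel_epi g]
  simp [hc, hd]

/-- Two maps `K ⟶ X` which are the left ends of ladders with the same right end differ by a map
which factors through `Y`. -/
lemma exists_factor_left {K Y X J : 𝒜} (i : K ⟶ Y) (f : X ⟶ J) [Mono f] {p q : Y ⟶ J} {a b : K ⟶ X}
    (hpq : p ≫ cokernel.π f = q ≫ cokernel.π f) (ha : a ≫ f = i ≫ p) (hb : b ≫ f = i ≫ q) :
    ∃ h : Y ⟶ X, a = b + i ≫ h := by
  refine ⟨Abelian.monoLift f (p - q) (by simp [hpq]), ?_⟩
  rw [← cancel_mono f]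
  simp [ha, hb]

/-- A map out of `G C` which vanishes on the image of `G J` does not distinguish maps into `C` which
are part of ladders with the same left end. -/
lemma map_comp_eq_of_ladder (G : 𝒜 ⥤ ℬ) [G.Additive] {Y Z J C : 𝒜} (g : Y ⟶ Z) [Epi g]
    {π : J ⟶ C} {T : ℬ} {k : G.obj C ⟶ T} (hk : G.map π ≫ k = 0) {p q : Y ⟶ J} {c d : Z ⟶ C}
    (hpq : kernel.ι g ≫ p = kernel.ι g ≫ q) (hc : g ≫ c = p ≫ π) (hd : g ≫ d = q ≫ π) :
    G.map c ≫ k = G.map d ≫ k := by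
  obtain ⟨h, rfl⟩ := exists_factor_right g π hpq hc hd
  simp [hk]

/-- A map into the kernel of `G K ⟶ G Y` does not distinguish maps out of `K` which are part of
ladders with the same right end. -/
lemma comp_map_eq_of_ladder (G : 𝒜 ⥤ ℬ) [G.Additive] {K Y X J : 𝒜} {i : K ⟶ Y} (f : X ⟶ J)
    [Mono f] {T : ℬ} {k : T ⟶ G.obj K} (hk : k ≫ G.map i = 0) {p q : Y ⟶ J} {a b : K ⟶ X}
    (hpq : p ≫ cokernel.π f = q ≫ cokernel.π f) (ha : a ≫ f = i ≫ p) (hb : b ≫ f = i ≫ q) :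
    k ≫ G.map a = k ≫ G.map b := by
  obtain ⟨h, rfl⟩ := exists_factor_left i f hpq ha hb
  simp [reassoc_of% hk]

/-! ### The maps `A ⟶ ΣΩA` and `ΩΣA ⟶ A` -/

/-- An extension `P ⟶ I` of the identity of `ΩA`, where `ΩA ⟶ I` is the chosen injective
presentation of `ΩA`. -/
def unitMid {A : 𝒜} (P : ProjectivePresentation A) (I : InjectivePresentation (syz P)) :
    P.p ⟶ I.J :=
  Injective.factorThru I.f (syzι P)

@[simp]
lemma syzι_unitMid {A : 𝒜} (P : ProjectivePresentation A) (I : InjectivePresentation (syz P)) :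
    syzι P ≫ unitMid P I = I.f :=
  Injective.comp_factorThru _ _

@[simp]
lemma syzι_unitMid_assoc {A Z : 𝒜} (P : ProjectivePresentation A)
    (I : InjectivePresentation (syz P)) (k : I.J ⟶ Z) : syzι P ≫ unitMid P I ≫ k = I.f ≫ k := by
  rw [← Category.assoc, syzι_unitMid]

/-- The map `A ⟶ ΣΩA` induced by an extension of the identity of `ΩA`. -/
def toCosyzSyz {A : 𝒜} (P : ProjectivePresentation A) (I : InjectivePresentation (syz P)) :
    A ⟶ cosyz I :=
  Abelian.epiDesc P.f (unitMid P I ≫ cosyzπ I) (by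
    rw [syzι_unitMid_assoc, cokernel.condition])

@[simp]
lemma f_toCosyzSyz {A : 𝒜} (P : ProjectivePresentation A) (I : InjectivePresentation (syz P)) :
    P.f ≫ toCosyzSyz P I = unitMid P I ≫ cosyzπ I :=
  Abelian.comp_epiDesc _ _ _

@[simp]
lemma f_toCosyzSyz_assoc {A Z : 𝒜} (P : ProjectivePresentation A)
    (I : InjectivePresentation (syz P)) (k : cosyz I ⟶ Z) :
    P.f ≫ toCosyzSyz P I ≫ k = unitMid P I ≫ cosyzπ I ≫ k := by
  rw [← Category.assoc, f_toCosyzSyz, Category.assoc]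

/-- A lifting `P ⟶ I` of the identity of `ΣA`, where `P ⟶ ΣA` is the chosen projective
presentation of `ΣA`. -/
def counitMid {A : 𝒜} (I : InjectivePresentation A) (P : ProjectivePresentation (cosyz I)) :
    P.p ⟶ I.J :=
  Projective.factorThru P.f (cosyzπ I)

@[simp]
lemma counitMid_cosyzπ {A : 𝒜} (I : InjectivePresentation A)
    (P : ProjectivePresentation (cosyz I)) : counitMid I P ≫ cosyzπ I = P.f :=
  Projective.factorThru_comp _ _

@[simp]
lemma counitMid_cosyzπ_assoc {A Z : 𝒜} (I : InjectivePresentation A)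
    (P : ProjectivePresentation (cosyz I)) (k : cosyz I ⟶ Z) :
    counitMid I P ≫ cosyzπ I ≫ k = P.f ≫ k := by
  rw [← Category.assoc, counitMid_cosyzπ]

/-- The map `ΩΣA ⟶ A` induced by a lifting of the identity of `ΣA`. -/
def ofSyzCosyz {A : 𝒜} (I : InjectivePresentation A) (P : ProjectivePresentation (cosyz I)) :
    syz P ⟶ A :=
  Abelian.monoLift I.f (syzι P ≫ counitMid I P) (by simp)

@[simp]
lemma ofSyzCosyz_f {A : 𝒜} (I : InjectivePresentation A) (P : ProjectivePresentation (cosyz I)) :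
    ofSyzCosyz I P ≫ I.f = syzι P ≫ counitMid I P :=
  Abelian.monoLift_comp _ _ _

@[simp]
lemma ofSyzCosyz_f_assoc {A Z : 𝒜} (I : InjectivePresentation A)
    (P : ProjectivePresentation (cosyz I)) (k : I.J ⟶ Z) :
    ofSyzCosyz I P ≫ I.f ≫ k = syzι P ≫ counitMid I P ≫ k := by
  rw [← Category.assoc, ofSyzCosyz_f, Category.assoc]

/-! ### The structure maps of the satellites -/

section StructureMaps

variable (P : ∀ A : 𝒜, ProjectivePresentation A) (I : ∀ A : 𝒜, InjectivePresentation A)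
variable (F : 𝒜 ⥤ ℬ) [F.Additive]

/-- The inclusion `S₁F A ⟶ F ΩA`, typed with source the value of the functor `S₁F`, so that it
composes with maps of satellite functors without unfolding them. -/
def leftSatι (A : 𝒜) : (leftSatFunctor P F).obj A ⟶ F.obj (syz (P A)) :=
  kernel.ι (F.map (syzι (P A)))

instance (A : 𝒜) : Mono (leftSatι P F A) :=
  inferInstanceAs (Mono (kernel.ι (F.map (syzι (P A)))))

@[simp]
lemma leftSatι_map (A : 𝒜) : leftSatι P F A ≫ F.map (syzι (P A)) = 0 :=
  kernel.condition _

/-- The map into `S₁F A` given by a map into the kernel of `F ΩA ⟶ F P`. -/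
def leftSatLift {A : 𝒜} {T : ℬ} (k : T ⟶ F.obj (syz (P A))) (hk : k ≫ F.map (syzι (P A)) = 0) :
    T ⟶ (leftSatFunctor P F).obj A :=
  kernel.lift _ k hk

@[simp]
lemma leftSatLift_ι {A : 𝒜} {T : ℬ} (k : T ⟶ F.obj (syz (P A)))
    (hk : k ≫ F.map (syzι (P A)) = 0) : leftSatLift P F k hk ≫ leftSatι P F A = k :=
  kernel.lift_ι _ _ _

lemma leftSatFunctor_map_ι {A A' : 𝒜} (f : A ⟶ A') :
    (leftSatFunctor P F).map f ≫ leftSatι P F A' =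
      leftSatι P F A ≫ F.map (liftS (P A) (P A') f) :=
  leftSatMap_ι _ _ _ _

lemma leftSatFunctorMap_app_ι {F G : 𝒜 ⥤ ℬ} [F.Additive] [G.Additive] (τ : F ⟶ G) (A : 𝒜) :
    (leftSatFunctorMap P τ).app A ≫ leftSatι P G A = leftSatι P F A ≫ τ.app (syz (P A)) :=
  leftSatTrans_ι _ _

/-- The projection `F ΣA ⟶ S¹F A`, typed with target the value of the functor `S¹F`. -/
def rightSatπ (A : 𝒜) : F.obj (cosyz (I A)) ⟶ (rightSatFunctor I F).obj A :=
  cokernel.π (F.map (cosyzπ (I A)))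

instance (A : 𝒜) : Epi (rightSatπ I F A) :=
  inferInstanceAs (Epi (cokernel.π (F.map (cosyzπ (I A)))))

@[simp]
lemma map_rightSatπ (A : 𝒜) : F.map (cosyzπ (I A)) ≫ rightSatπ I F A = 0 :=
  cokernel.condition _

/-- The map out of `S¹F A` given by a map out of `F ΣA` which vanishes on the image of `F I`. -/
def rightSatDesc {A : 𝒜} {T : ℬ} (k : F.obj (cosyz (I A)) ⟶ T)
    (hk : F.map (cosyzπ (I A)) ≫ k = 0) : (rightSatFunctor I F).obj A ⟶ T :=
  cokernel.desc _ k hk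

@[simp]
lemma π_rightSatDesc {A : 𝒜} {T : ℬ} (k : F.obj (cosyz (I A)) ⟶ T)
    (hk : F.map (cosyzπ (I A)) ≫ k = 0) : rightSatπ I F A ≫ rightSatDesc I F k hk = k :=
  cokernel.π_desc _ _ _

lemma π_rightSatFunctor_map {A A' : 𝒜} (f : A ⟶ A') :
    rightSatπ I F A ≫ (rightSatFunctor I F).map f =
      F.map (extC (I A) (I A') f) ≫ rightSatπ I F A' :=
  π_rightSatMap _ _ _ _

lemma π_rightSatFunctorMap_app {F G : 𝒜 ⥤ ℬ} [F.Additive] [G.Additive] (τ : F ⟶ G) (A : 𝒜) :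
    rightSatπ I F A ≫ (rightSatFunctorMap I τ).app A = τ.app (cosyz (I A)) ≫ rightSatπ I G A :=
  π_rightSatTrans _ _

end StructureMaps

/-! ### Unit and counit -/

variable (P : ∀ A : 𝒜, ProjectivePresentation A) (I : ∀ A : 𝒜, InjectivePresentation A)

/-- The component `F A ⟶ S₁S¹F A` of the unit, given by `F A ⟶ F ΣΩA ⟶ S¹F ΩA`. -/
def unitApp (F : 𝒜 ⥤ ℬ) [F.Additive] (A : 𝒜) :
    F.obj A ⟶ (leftSatFunctor P (rightSatFunctor I F)).obj A :=
  leftSatLift _ _ (F.map (toCosyzSyz (P A) (I _)) ≫ rightSatπ I F (syz (P A))) (by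
    rw [Category.assoc, π_rightSatFunctor_map, ← F.map_comp_assoc,
      -- The extensions `P ⟶ I(ΩA) ⟶ I(P)` and `P ⟶ I(P)` of `ΩA ⟶ P` are compared.
      map_comp_eq_of_ladder F (P A).f (map_rightSatπ I F _) (d := 0)
        (p := unitMid (P A) (I _) ≫ extI (I _) (I _) (syzι (P A))) (q := (I (P A).p).f)
        (by simp) (by simp) (by simp)]
    simp)

@[simp]
lemma unitApp_ι (F : 𝒜 ⥤ ℬ) [F.Additive] (A : 𝒜) :
    unitApp P I F A ≫ leftSatι P (rightSatFunctor I F) A =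
      F.map (toCosyzSyz (P A) (I _)) ≫ rightSatπ I F (syz (P A)) :=
  leftSatLift_ι _ _ _ _

/-- The component `S¹S₁F A ⟶ F A` of the counit, induced by `S₁F ΣA ⟶ F ΩΣA ⟶ F A`. -/
def counitApp (F : 𝒜 ⥤ ℬ) [F.Additive] (A : 𝒜) :
    (rightSatFunctor I (leftSatFunctor P F)).obj A ⟶ F.obj A :=
  rightSatDesc _ _ (leftSatι P F (cosyz (I A)) ≫ F.map (ofSyzCosyz (I A) (P _))) (by
    rw [reassoc_of% leftSatFunctor_map_ι, ← F.map_comp,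
      -- The liftings `P(I) ⟶ P(ΣA) ⟶ I` and `P(I) ⟶ I` of `I ⟶ ΣA` are compared.
      comp_map_eq_of_ladder F (I A).f (leftSatι_map P F _) (b := 0)
        (p := liftP (P _) (P _) (cosyzπ (I A)) ≫ counitMid (I A) (P _)) (q := (P (I A).J).f)
        (by simp) (by simp) (by simp)]
    simp)

@[simp]
lemma π_counitApp (F : 𝒜 ⥤ ℬ) [F.Additive] (A : 𝒜) :
    rightSatπ I (leftSatFunctor P F) A ≫ counitApp P I F A =
      leftSatι P F (cosyz (I A)) ≫ F.map (ofSyzCosyz (I A) (P _)) :=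
  π_rightSatDesc _ _ _ _

/-- The unit `F ⟶ S₁S¹F`. -/
@[simps]
def unitTrans (F : 𝒜 ⥤ ℬ) [F.Additive] : F ⟶ leftSatFunctor P (rightSatFunctor I F) where
  app A := unitApp P I F A
  naturality A A' f := by
    rw [← cancel_mono (leftSatι P (rightSatFunctor I F) A'), Category.assoc, unitApp_ι,
      Category.assoc, leftSatFunctor_map_ι, reassoc_of% unitApp_ι, π_rightSatFunctor_map,
      ← F.map_comp_assoc, ← F.map_comp_assoc]
    exact map_comp_eq_of_ladder F (P A).f (map_rightSatπ I F _)
      (p := liftP (P A) (P A') f ≫ unitMid (P A') (I _))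
      (q := unitMid (P A) (I _) ≫ extI (I _) (I _) (liftS (P A) (P A') f))
      (by rw [← liftS_comp_assoc]; simp)
      (by rw [← liftP_comp_assoc, f_toCosyzSyz, Category.assoc]) (by simp)

/-- The counit `S¹S₁F ⟶ F`. -/
@[simps]
def counitTrans (F : 𝒜 ⥤ ℬ) [F.Additive] : rightSatFunctor I (leftSatFunctor P F) ⟶ F where
  app A := counitApp P I F A
  naturality A A' f := by
    rw [← cancel_epi (rightSatπ I (leftSatFunctor P F) A), reassoc_of% π_counitApp,
      reassoc_of% π_rightSatFunctor_map, π_counitApp, reassoc_of% leftSatFunctor_map_ι,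
      ← F.map_comp, ← F.map_comp]
    exact comp_map_eq_of_ladder F (I A').f (leftSatι_map P F _)
      (p := liftP (P _) (P _) (extC (I A) (I A') f) ≫ counitMid (I A') (P _))
      (q := counitMid (I A) (P _) ≫ extI (I A) (I A') f)
      (by simp [← comp_extC]) (by simp)
      (by rw [Category.assoc, ← comp_extI (I A), ofSyzCosyz_f_assoc])

/-- The composite `ΣA ⟶ ΣΩΣA ⟶ ΣA` agrees with the identity up to a map through `I ⟶ ΣA`. -/
lemma left_triangle (F : 𝒜 ⥤ ℬ) [F.Additive] (A : 𝒜) :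
    (rightSatFunctorMap I (unitTrans P I F)).app A ≫ counitApp P I (rightSatFunctor I F) A =
      𝟙 ((rightSatFunctor I F).obj A) := by
  rw [← cancel_epi (rightSatπ I F A), reassoc_of% π_rightSatFunctorMap_app, π_counitApp,
    unitTrans_app, reassoc_of% unitApp_ι, π_rightSatFunctor_map, ← F.map_comp_assoc,
    map_comp_eq_of_ladder F (P (cosyz (I A))).f (map_rightSatπ I F _) (d := 𝟙 _)
      (p := unitMid (P _) (I _) ≫ extI (I _) (I _) (ofSyzCosyz (I A) (P _)))
      (q := counitMid (I A) (P _)) (by simp) (by simp) (by simp)]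
  simp

/-- The composite `ΩA ⟶ ΩΣΩA ⟶ ΩA` agrees with the identity up to a map through `ΩA ⟶ P`. -/
lemma right_triangle (F : 𝒜 ⥤ ℬ) [F.Additive] (A : 𝒜) :
    unitApp P I (leftSatFunctor P F) A ≫ (leftSatFunctorMap P (counitTrans P I F)).app A =
      𝟙 ((leftSatFunctor P F).obj A) := by
  rw [← cancel_mono (leftSatι P F A), Category.assoc, leftSatFunctorMap_app_ι,
    reassoc_of% unitApp_ι, counitTrans_app, π_counitApp, reassoc_of% leftSatFunctor_map_ι,
    ← F.map_comp, comp_map_eq_of_ladder F (I _).f (leftSatι_map P F _) (b := 𝟙 _)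
      (p := liftP (P A) (P _) (toCosyzSyz (P A) (I _)) ≫ counitMid (I _) (P _))
      (q := unitMid (P A) (I _)) (by simp) (by simp) (by simp)]
  simp

/-- The adjunction `S¹ ⊣ S₁`. -/
def adjunction : (rightSat I : (𝒜 ⥤+ ℬ) ⥤ (𝒜 ⥤+ ℬ)) ⊣ leftSat P :=
  Adjunction.mkOfUnitCounit
    { unit :=
        { app F := ObjectProperty.homMk (unitTrans P I F.obj)
          naturality F G τ := by
            ext A
            change τ.hom.app A ≫ unitApp P I G.obj A =
              unitApp P I F.obj A ≫ (leftSatFunctorMap P (rightSatFunctorMap I τ.hom)).app A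
            rw [← cancel_mono (leftSatι P (rightSatFunctor I G.obj) A), Category.assoc, unitApp_ι,
              Category.assoc, leftSatFunctorMap_app_ι, reassoc_of% unitApp_ι,
              π_rightSatFunctorMap_app, τ.hom.naturality_assoc] }
      counit :=
        { app F := ObjectProperty.homMk (counitTrans P I F.obj)
          naturality F G τ := by
            ext A
            change (rightSatFunctorMap I (leftSatFunctorMap P τ.hom)).app A ≫
              counitApp P I G.obj A = counitApp P I F.obj A ≫ τ.hom.app A
            rw [← cancel_epi (rightSatπ I (leftSatFunctor P F.obj) A),
              reassoc_of% π_rightSatFunctorMap_app, π_counitApp,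
              reassoc_of% leftSatFunctorMap_app_ι, reassoc_of% π_counitApp, τ.hom.naturality] }
      left_triangle := by
        ext F A
        exact (congrArg _ (Category.id_comp _)).trans (left_triangle P I F.obj A)
      right_triangle := by
        ext F A
        exact (congrArg _ (Category.id_comp _)).trans (right_triangle P I F.obj A) }

/-! ### The long exact sequence of a half-exact functor -/

section HalfExact

variable {S : ShortComplex 𝒜}

/-- For a projective presentation `Q` of `Z`, a short exact sequence `0 ⟶ X ⟶ Y ⟶ Z ⟶ 0` gives a
short exact sequence `0 ⟶ ΩZ ⟶ X ⊞ Q ⟶ Y ⟶ 0`. -/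
lemma shortExact_biprod (hS : S.ShortExact) (Q : ProjectivePresentation S.X₃) {l : Q.p ⟶ S.X₂}
    {a : syz Q ⟶ S.X₁} (hl : l ≫ S.g = Q.f) (ha : a ≫ S.f = syzι Q ≫ l) :
    (ShortComplex.mk (biprod.lift a (-syzι Q)) (biprod.desc S.f l) (by simp [ha])).ShortExact := by
  have := hS.mono_f
  have := hS.epi_g
  refine ShortComplex.ShortExact.mk' ?_ ?_ ?_
  · rw [ShortComplex.exact_iff_exact_up_to_refinements]
    intro T x hx
    dsimp at x hx ⊢
    have hx' : x ≫ biprod.fst ≫ S.f + x ≫ biprod.snd ≫ l = 0 := by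
      simpa [biprod.desc_eq] using hx
    have h0 : (x ≫ biprod.snd) ≫ Q.f = 0 := by
      simpa [hl] using hx' =≫ S.g
    have hy : kernel.lift Q.f _ h0 ≫ syzι Q = x ≫ biprod.snd := kernel.lift_ι _ _ _
    refine ⟨T, 𝟙 T, inferInstance, -kernel.lift Q.f _ h0, ?_⟩
    apply biprod.hom_ext
    · rw [← cancel_mono S.f]
      simp only [Category.id_comp, Category.assoc, biprod.lift_fst, Preadditive.neg_comp, ha]
      rw [← Category.assoc (kernel.lift Q.f _ h0), hy, Category.assoc]
      exact eq_neg_of_add_eq_zero_left hx'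
    · simp
  · have : Mono (biprod.lift a (-syzι Q) ≫ (-biprod.snd)) := by
      simpa using (inferInstance : Mono (syzι Q))
    exact mono_of_mono _ (-biprod.snd)
  · rw [epi_iff_surjective_up_to_refinements]
    intro T y
    dsimp at y ⊢
    obtain ⟨T', e, he, p, hp⟩ := surjective_up_to_refinements_of_epi Q.f (y ≫ S.g)
    refine ⟨T', e, he, biprod.lift (hS.exact.lift (e ≫ y - p ≫ l) (by simp [hl, hp])) p, ?_⟩
    rw [biprod.lift_desc, hS.exact.lift_f]
    simp

/-- Exactness of `F X ⟶ F Y ⟶ F Z` on generalized elements: maps lift after an epimorphism. -/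
lemma HalfExact.exists_lift {F : 𝒜 ⥤+ ℬ} (hF : HalfExact F) {X Y Z : 𝒜} {f : X ⟶ Y} {g : Y ⟶ Z}
    {w : f ≫ g = 0} (h : (ShortComplex.mk f g w).ShortExact) {T : ℬ} (x : T ⟶ F.obj.obj Y)
    (hx : x ≫ F.obj.map g = 0) :
    ∃ (T' : ℬ) (e : T' ⟶ T) (_ : Epi e) (y : T' ⟶ F.obj.obj X), e ≫ x = y ≫ F.obj.map f :=
  (hF _ h).exact_up_to_refinements x hx

/-- For a half-exact functor `F`, the sequence `S₁F Z ⟶ F X ⟶ F Y` is exact. -/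
lemma HalfExact.exists_lift_leftSatObj {F : 𝒜 ⥤+ ℬ} (hF : HalfExact F) (hS : S.ShortExact)
    (Q : ProjectivePresentation S.X₃) {l : Q.p ⟶ S.X₂} {a : syz Q ⟶ S.X₁} (hl : l ≫ S.g = Q.f)
    (ha : a ≫ S.f = syzι Q ≫ l) {T : ℬ} (x : T ⟶ F.obj.obj S.X₁) (hx : x ≫ F.obj.map S.f = 0) :
    ∃ (T' : ℬ) (e : T' ⟶ T) (_ : Epi e) (w : T' ⟶ leftSatObj F.obj Q),
      e ≫ x = w ≫ kernel.ι _ ≫ F.obj.map a := by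
  obtain ⟨T', e, he, w, hw⟩ := hF.exists_lift (shortExact_biprod hS Q hl ha)
    (x ≫ F.obj.map biprod.inl) (by rw [Category.assoc, ← F.obj.map_comp, biprod.inl_desc, hx])
  have h₁ : e ≫ x = w ≫ F.obj.map a := by
    simpa [← F.obj.map_comp] using hw =≫ F.obj.map biprod.fst
  have h₂ : w ≫ F.obj.map (syzι Q) = 0 := by
    simpa [← F.obj.map_comp] using (hw =≫ F.obj.map biprod.snd).symm
  exact ⟨T', e, he, kernel.lift _ w h₂, by simp [h₁]⟩

/-- For a projective presentation `R` of `Y`, a short exact sequence `0 ⟶ X ⟶ Y ⟶ Z ⟶ 0` gives a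
short exact sequence `0 ⟶ ΩY ⟶ K ⟶ X ⟶ 0`, where `K` is the kernel of `R ⟶ Y ⟶ Z`. -/
lemma shortExact_kernel_comp (hS : S.ShortExact) (R : ProjectivePresentation S.X₂)
    {j : syz R ⟶ kernel (R.f ≫ S.g)} {k : kernel (R.f ≫ S.g) ⟶ S.X₁}
    (hj : j ≫ kernel.ι (R.f ≫ S.g) = syzι R) (hk : k ≫ S.f = kernel.ι (R.f ≫ S.g) ≫ R.f) :
    ∃ w : j ≫ k = 0, (ShortComplex.mk j k w).ShortExact := by
  have := hS.mono_f
  refine ⟨?_, ShortComplex.ShortExact.mk' ?_ ?_ ?_⟩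
  · rw [← cancel_mono S.f, Category.assoc, hk, reassoc_of% hj]
    simp
  · rw [ShortComplex.exact_iff_exact_up_to_refinements]
    intro T x hx
    dsimp at x hx ⊢
    refine ⟨T, 𝟙 T, inferInstance, kernel.lift R.f (x ≫ kernel.ι _) ?_, ?_⟩
    · rw [Category.assoc, ← hk, reassoc_of% hx, zero_comp]
    · rw [← cancel_mono (kernel.ι (R.f ≫ S.g))]
      simp [hj]
  · have : Mono (j ≫ kernel.ι (R.f ≫ S.g)) := by rw [hj]; infer_instance
    exact mono_of_mono j (kernel.ι (R.f ≫ S.g))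
  · rw [epi_iff_surjective_up_to_refinements]
    intro T x
    dsimp at x ⊢
    obtain ⟨T', e, he, p, hp⟩ := surjective_up_to_refinements_of_epi R.f (x ≫ S.f)
    refine ⟨T', e, he, kernel.lift _ p (by rw [← reassoc_of% hp]; simp), ?_⟩
    rw [← cancel_mono S.f]
    simp [hk, hp]

/-- For a half-exact functor `F`, the sequence `S₁F Y ⟶ S₁F Z ⟶ F X` is exact. -/
lemma HalfExact.exists_lift_leftSatMap {F : 𝒜 ⥤+ ℬ} (hF : HalfExact F) (hS : S.ShortExact)
    (R : ProjectivePresentation S.X₂) (Q : ProjectivePresentation S.X₃) {l : Q.p ⟶ S.X₂}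
    {a : syz Q ⟶ S.X₁} (hl : l ≫ S.g = Q.f) (ha : a ≫ S.f = syzι Q ≫ l)
    {T : ℬ} (w : T ⟶ leftSatObj F.obj Q) (hw : w ≫ kernel.ι _ ≫ F.obj.map a = 0) :
    ∃ (T' : ℬ) (e : T' ⟶ T) (_ : Epi e) (v : T' ⟶ leftSatObj F.obj R),
      e ≫ w = v ≫ leftSatMap F.obj R Q S.g := by
  have := hS.mono_f
  have := hS.epi_g
  let κ := kernel.ι (R.f ≫ S.g)
  let j : syz R ⟶ kernel (R.f ≫ S.g) := kernel.lift _ (syzι R) (by simp)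
  have hj : j ≫ κ = syzι R := kernel.lift_ι _ _ _
  let k : kernel (R.f ≫ S.g) ⟶ S.X₁ := hS.exact.lift (κ ≫ R.f) (by simp [κ])
  have hk : k ≫ S.f = κ ≫ R.f := hS.exact.lift_f _ _
  -- `R ⟶ Y ⟶ Z` is a second projective presentation of `Z`, with syzygy object `K`; the maps
  -- `t : ΩZ ⟶ K` and `u : K ⟶ ΩZ` compare it with `Q`.
  let m : Q.p ⟶ R.p := Projective.factorThru Q.f (R.f ≫ S.g)
  have hm : m ≫ R.f ≫ S.g = Q.f := Projective.factorThru_comp _ _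
  let t : syz Q ⟶ kernel (R.f ≫ S.g) := kernel.lift _ (syzι Q ≫ m) (by simp [hm])
  have ht : t ≫ κ = syzι Q ≫ m := kernel.lift_ι _ _ _
  let u : kernel (R.f ≫ S.g) ⟶ syz Q := kernel.lift _ (κ ≫ liftP R Q S.g) (by simp [κ])
  have hu : u ≫ syzι Q = κ ≫ liftP R Q S.g := kernel.lift_ι _ _ _
  have hju : j ≫ u = liftS R Q S.g := by
    rw [← cancel_mono (syzι Q)]
    simp [hu, reassoc_of% hj]
  obtain ⟨h, hh⟩ : ∃ h : Q.p ⟶ S.X₁, t ≫ k = a + syzι Q ≫ h := by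
    refine ⟨hS.exact.lift (m ≫ R.f - l) (by simp [hm, hl]), ?_⟩
    rw [← cancel_mono S.f]
    simp [ha, hk, reassoc_of% ht]
  obtain ⟨h', hh'⟩ : ∃ h : Q.p ⟶ syz Q, t ≫ u = 𝟙 _ + syzι Q ≫ h :=
    exists_factor_syz Q Q (p := m ≫ liftP R Q S.g) (q := 𝟙 _) (by simp [hm])
      (by simp [hu, reassoc_of% ht]) (by simp)
  obtain ⟨z, hz⟩ := shortExact_kernel_comp hS R hj hk
  obtain ⟨T', e, he, v, hv⟩ := hF.exists_lift hz
    (w ≫ kernel.ι _ ≫ F.obj.map t) (by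
      simp only [Category.assoc, ← F.obj.map_comp, hh]
      simp [hw])
  have hv₀ : v ≫ F.obj.map (syzι R) = 0 := by
    rw [← hj, F.obj.map_comp, ← reassoc_of% hv, ← F.obj.map_comp, ht]
    simp
  refine ⟨T', e, he, kernel.lift _ v hv₀, ?_⟩
  rw [← cancel_mono (kernel.ι (F.obj.map (syzι Q)))]
  simp only [Category.assoc, leftSatMap_ι, kernel.lift_ι_assoc]
  rw [← hju, F.obj.map_comp, ← reassoc_of% hv, ← F.obj.map_comp, hh']
  simp

end HalfExact

/-! ### The injective stabilization as a kernel -/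

/-- The kernel of `F A ⟶ R⁰F A` is the kernel of `F A ⟶ F I`, for any embedding of `A` in an
injective object `I`. -/
lemma comp_toRightDerivedZero_eq_zero_iff [EnoughInjectives 𝒜] (F : 𝒜 ⥤ ℬ) [F.Additive] {A : 𝒜}
    (J : InjectivePresentation A) {T : ℬ} (x : T ⟶ F.obj A) :
    x ≫ F.toRightDerivedZero.app A = 0 ↔ x ≫ F.map J.f = 0 := by
  have := J.mono
  constructor
  · intro h
    -- `F J ⟶ R⁰F J` is an isomorphism since `J` is injective.
    rw [← cancel_mono (F.toRightDerivedZero.app J.J), Category.assoc,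
      F.toRightDerivedZero.naturality, reassoc_of% h, zero_comp, zero_comp]
  · intro h
    let L := injectiveResolution A
    have h' : x ≫ F.map (L.ι.f 0) = 0 := by
      let i : A ⟶ L.cocomplex.X 0 := L.ι.f 0
      have hi : J.f ≫ Injective.factorThru i J.f = i := Injective.comp_factorThru _ _
      change x ≫ F.map i = 0
      rw [← hi, F.map_comp, reassoc_of% h, zero_comp]
    have h'' : x ≫ L.toRightDerivedZero' F = 0 := by
      rw [← cancel_mono (HomologicalComplex.iCycles _ _), Category.assoc,
        L.toRightDerivedZero'_comp_iCycles, zero_comp]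
      exact h'
    rw [L.toRightDerivedZero_eq F, reassoc_of% h'', zero_comp]

/-! ### The counit at a half-exact functor -/

lemma cosyz_shortExact {A : 𝒜} (J : InjectivePresentation A) :
    (ShortComplex.mk J.f (cosyzπ J) (cokernel.condition _)).ShortExact where
  exact := ShortComplex.exact_cokernel _

variable {P I} in
/-- The counit is injective, by exactness of `S₁F I ⟶ S₁F ΣA ⟶ F A`. -/
lemma HalfExact.mono_counitApp {F : 𝒜 ⥤+ ℬ} (hF : HalfExact F) (A : 𝒜) :
    Mono (counitApp P I F.obj A) := by
  apply Preadditive.mono_of_cancel_zero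
  intro T x hx
  obtain ⟨T₁, e₁, _, w, hw⟩ := surjective_up_to_refinements_of_epi
    (rightSatπ I (leftSatFunctor P F.obj) A) x
  obtain ⟨T₂, e₂, _, v, hv⟩ :
      ∃ (T₂ : ℬ) (e₂ : T₂ ⟶ T₁) (_ : Epi e₂) (v : T₂ ⟶ (leftSatFunctor P F.obj).obj (I A).J),
        e₂ ≫ w = v ≫ (leftSatFunctor P F.obj).map (cosyzπ (I A)) :=
    hF.exists_lift_leftSatMap (cosyz_shortExact (I A)) (P _) (P _)
      (counitMid_cosyzπ (I A) (P _)) (ofSyzCosyz_f (I A) (P _)) w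
      ((by rw [← π_counitApp, ← reassoc_of% hw, hx, comp_zero] :
        w ≫ leftSatι P F.obj _ ≫ F.obj.map (ofSyzCosyz (I A) (P _)) = 0))
  rw [← cancel_epi e₁, ← cancel_epi e₂, hw, reassoc_of% hv, map_rightSatπ]
  simp

variable {P I} in
/-- The image of the counit contains the kernel of `F A ⟶ F I`, by exactness of
`S₁F ΣA ⟶ F A ⟶ F I`. -/
lemma HalfExact.exists_lift_counitApp {F : 𝒜 ⥤+ ℬ} (hF : HalfExact F) {A : 𝒜} {T : ℬ}
    (x : T ⟶ F.obj.obj A) (hx : x ≫ F.obj.map (I A).f = 0) :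
    ∃ (T' : ℬ) (e : T' ⟶ T) (_ : Epi e)
      (y : T' ⟶ (rightSatFunctor I (leftSatFunctor P F.obj)).obj A),
      e ≫ x = y ≫ counitApp P I F.obj A := by
  obtain ⟨T', e, he, w, hw⟩ :
      ∃ (T' : ℬ) (e : T' ⟶ T) (_ : Epi e) (w : T' ⟶ (leftSatFunctor P F.obj).obj (cosyz (I A))),
        e ≫ x = w ≫ leftSatι P F.obj _ ≫ F.obj.map (ofSyzCosyz (I A) (P _)) :=
    hF.exists_lift_leftSatObj (cosyz_shortExact (I A)) (P _)
      (counitMid_cosyzπ (I A) (P _)) (ofSyzCosyz_f (I A) (P _)) x hx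
  exact ⟨T', e, he, w ≫ rightSatπ I (leftSatFunctor P F.obj) A,
    by rw [hw, Category.assoc, π_counitApp]⟩

lemma counitApp_comp_map (F : 𝒜 ⥤ ℬ) [F.Additive] (A : 𝒜) :
    counitApp P I F A ≫ F.map (I A).f = 0 := by
  rw [← cancel_epi (rightSatπ I (leftSatFunctor P F) A), reassoc_of% π_counitApp, ← F.map_comp,
    ofSyzCosyz_f, F.map_comp, reassoc_of% leftSatι_map]
  simp

variable {P I} in
/-- The counit at a half-exact functor is isomorphic to the inclusion of the injective
stabilization. -/
lemma HalfExact.exists_iso_injStab [EnoughInjectives 𝒜] {F : 𝒜 ⥤+ ℬ} (hF : HalfExact F) :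
    ∃ e : (rightSat I).obj ((leftSat P).obj F) ≅ injStab F,
      e.hom ≫ injStabι F = (adjunction P I).counit.app F := by
  let φ : rightSatFunctor I (leftSatFunctor P F.obj) ⟶ kernel F.obj.toRightDerivedZero :=
    kernel.lift _ (counitTrans P I F.obj) (by
      ext A
      exact (comp_toRightDerivedZero_eq_zero_iff F.obj (I A) _).2 (counitApp_comp_map P I F.obj A))
  have hφ : φ ≫ kernel.ι F.obj.toRightDerivedZero = counitTrans P I F.obj := kernel.lift_ι _ _ _
  have hφ' (A : 𝒜) : φ.app A ≫ (kernel.ι F.obj.toRightDerivedZero).app A =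
      counitApp P I F.obj A := NatTrans.congr_app hφ A
  have (A : 𝒜) : IsIso (φ.app A) := by
    have : Mono (φ.app A ≫ (kernel.ι F.obj.toRightDerivedZero).app A) := by
      rw [hφ']
      exact hF.mono_counitApp A
    have := mono_of_mono (φ.app A) ((kernel.ι F.obj.toRightDerivedZero).app A)
    have : Epi (φ.app A) := by
      rw [epi_iff_surjective_up_to_refinements]
      intro T x
      obtain ⟨T', e, he, y, hy⟩ := hF.exists_lift_counitApp (P := P) (I := I)
        (x ≫ (kernel.ι F.obj.toRightDerivedZero).app A)
        ((comp_toRightDerivedZero_eq_zero_iff F.obj (I A) _).1 (by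
          rw [Category.assoc, ← NatTrans.comp_app, kernel.condition]
          simp))
      refine ⟨T', e, he, y, ?_⟩
      rw [← cancel_mono ((kernel.ι F.obj.toRightDerivedZero).app A)]
      simp only [Category.assoc]
      rw [hφ', hy]
    exact isIso_of_mono_of_epi _
  have : IsIso φ := NatIso.isIso_of_isIso_app φ
  let e : rightSatFunctor I (leftSatFunctor P F.obj) ≅ kernel F.obj.toRightDerivedZero := asIso φ
  refine ⟨ObjectProperty.isoMk _ e, ?_⟩
  ext A
  exact hφ' A

end Satellite

end

theorem mainTheorem6
    {𝒜 : Type u₁} [Category.{v₁} 𝒜] [Abelian 𝒜]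
    {ℬ : Type u₂} [Category.{v₂} ℬ] [Abelian ℬ]
    [EnoughProjectives 𝒜] [EnoughInjectives 𝒜]
    (P : ∀ A : 𝒜, ProjectivePresentation A) (I : ∀ A : 𝒜, InjectivePresentation A) :
    Nonempty ((Satellite.rightSat I : (𝒜 ⥤+ ℬ) ⥤ (𝒜 ⥤+ ℬ)) ⊣ Satellite.leftSat P) ∧
    ∀ (adj : (Satellite.rightSat I : (𝒜 ⥤+ ℬ) ⥤ (𝒜 ⥤+ ℬ)) ⊣ Satellite.leftSat P)
      (F : 𝒜 ⥤+ ℬ), Satellite.HalfExact F →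
      ∃ e : (Satellite.rightSat I).obj ((Satellite.leftSat P).obj F) ≅ Satellite.injStab F,
        e.hom ≫ Satellite.injStabι F = adj.counit.app F := by
  refine ⟨⟨Satellite.adjunction P I⟩, fun adj F hF => ?_⟩
  obtain ⟨e, he⟩ := hF.exists_iso_injStab (P := P) (I := I)
  -- Any other adjunction differs from the constructed one by an automorphism of `S¹`.
  refine ⟨(adj.leftAdjointUniq (Satellite.adjunction P I)).app _ ≪≫ e, ?_⟩
  rw [Iso.trans_hom, Category.assoc, he]
  exact Adjunction.leftAdjointUniq_hom_app_counit _ _ _
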